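/- Let $X$ and $Y$ be locally compact Hausdorff spaces. Let $\mathcal{E}$ and $\mathcal{F}$ be two $C^*$-correspondences from $C_0(Y)$ to $C_0(X)$, i.e. right Hilbert $C_0(X)$-modules together with $*$-homomorphisms $\varphi_{\mathcal E}:C_0(Y)\to\mathcal{L}(\mathcal{E})$ and $\varphi_{\mathcal F}:C_0(Y)\to\mathcal{L}(\mathcal{F})$ into the adjointable operators. Assume that each of them is - proper: $\varphi$ takes values in the compact operators $\mathcal{K}(\cdot)$, the closed linear span of the operators $\zeta\mapsto\xi\langle\eta,\zeta\rangle$; - nondegenerate: the linear span of $\varphi(C_0(Y))\mathcal{E}$ is dense in $\mathcal{E}$ (and likewise for $\mathcal{F}$); - full: the linear span of $\langle\mathcal{E},\mathcal{E}\rangle$ is dense in $C_0(X)$ (and likewise for $\mathcal{F}$); - $\sigma$-finitely generated and $\sigma$-projective: for every compact $K\subseteq X$ the restriction of the module to $K$ is a finitely generated projective $C(K)$-module. Let $\iota_{\mathcal E}$ map $f\in C_0(X)$ to the operator $\xi\mapsto\xi f$ on $\mathcal{E}$, and let $D_{\mathcal E}=C^*(\operatorname{im}\iota_{\mathcal E},\operatorname{im}\varphi_{\mathcal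 E})$ be the (commutative) $C^*$-algebra generated by the images of $\iota_{\mathcal E}$ and $\varphi_{\mathcal E}$, with character space $\widehat{D}_{\mathcal E}$. Then $\iota_{\mathcal E}:C_0(X)\to D_{\mathcal E}$ and $\varphi_{\mathcal E}:C_0(Y)\to D_{\mathcal E}$ have Gelfand duals, i.e. there are (unique) proper continuous maps $s_{\mathcal E}:\widehat{D}_{\mathcal E}\to X$ and $r_{\mathcal E}:\widehat{D}_{\mathcal E}\to Y$ with $\chi(\iota_{\mathcal E}(f))=f(s_{\mathcal E}(\chi))$ and $\chi(\varphi_{\mathcal E}(g))=g(r_{\mathcal E}(\chi))$ for all $\chi\in\widehat{D}_{\mathcal E}$, $f\in C_0(X)$, $g\in C_0(Y)$; similarly for $\mathcal{F}$. The following are equivalent: 1. There is a $*$-isomorphism $\phi:D_{\mathcal E}\to D_{\mathcal F}$ such that $\phi\circ\iota_{\mathcal E}=\iota_{\mathcal F}$ and $\phi\circ\varphi_{\mathcal E}=\varphi_{\mathcal F}$. 2. $r_{\mathcal E}(s_{\mathcal E}^{-1}(x))=r_{\mathcal F}(s_{\mathcal F}^{-1}(x))$ for all $x\in X$. If an isomorphism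 as in (1) exists, then it is unique. -/

import Mathlib

open scoped ZeroAtInfty ComplexOrder
open TopologicalSpace

noncomputable section

/-! ### The pointwise order on `C₀(X, ℂ)` -/

set_option linter.unusedSectionVars false

section Order

variable {X : Type*} [TopologicalSpace X]

/-- The pointwise order on `C₀(X, ℂ)`; it is the usual order of this C⋆-algebra. -/
instance ZeroAtInftyContinuousMap.instPartialOrderComplex : PartialOrder C₀(X, ℂ) :=
  PartialOrder.lift (fun f : C₀(X, ℂ) => (f : X → ℂ)) DFunLike.coe_injective

theorem ZeroAtInftyContinuousMap.complex_le_iff {f g : C₀(X, ℂ)} :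
    f ≤ g ↔ ∀ x, f x ≤ g x := Iff.rfl

instance ZeroAtInftyContinuousMap.instStarOrderedRingComplex : StarOrderedRing C₀(X, ℂ) := by
  refine StarOrderedRing.of_nonneg_iff' (fun {f g} h k x => ?_) (fun f => ⟨fun h => ?_, ?_⟩)
  · exact add_le_add_right (h x) (k x)
  · have hc : Continuous fun x => ((Real.sqrt (f x).re : ℝ) : ℂ) := by
      have := map_continuous f
      fun_prop
    refine ⟨⟨⟨_, hc⟩, ?_⟩, ?_⟩
    · have h0 := zero_at_infty f
      have h1 : Continuous fun z : ℂ => ((Real.sqrt z.re : ℝ) : ℂ) := by fun_prop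
      have h2 := (h1.tendsto 0).comp h0
      simpa [Function.comp_def] using h2
    · ext x
      have hx : 0 ≤ f x := h x
      obtain ⟨hr, hi⟩ := Complex.nonneg_iff.mp hx
      change f x = star ((Real.sqrt (f x).re : ℝ) : ℂ) * ((Real.sqrt (f x).re : ℝ) : ℂ)
      rw [Complex.star_def, Complex.conj_ofReal, ← Complex.ofReal_mul, Real.mul_self_sqrt hr]
      apply Complex.ext
      · simp
      · simp [← hi]
  · rintro ⟨s, rfl⟩ x
    exact star_mul_self_nonneg (s x)

end Order

/-! ### Adjointable operators on a Hilbert module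

A Hilbert module over a commutative C⋆-algebra `A` is a complete `CStarModule A E`; as `A` is
commutative, the right action `ξ · a` is written `a • ξ`. -/

namespace HilbertModule

section Basic

variable {A E : Type*} [NonUnitalCommCStarAlgebra A] [PartialOrder A] [StarOrderedRing A]
  [SMul A E] [NormedAddCommGroup E] [NormedSpace ℂ E] [CStarModule A E]

variable (A) in
theorem ext_inner {x y : E} (h : ∀ z : E, inner A z x = inner A z y) : x = y := by
  rw [← sub_eq_zero, ← CStarModule.inner_self (A := A), CStarModule.inner_sub_right, h, sub_self]

theorem smul_add' (a : A) (x y : E) : a • (x + y) = a • x + a • y :=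
  ext_inner A fun z => by simp [mul_add]

theorem add_smul' (a b : A) (x : E) : (a + b) • x = a • x + b • x :=
  ext_inner A fun z => by simp [add_mul]

theorem mul_smul' (a b : A) (x : E) : (a * b) • x = a • b • x :=
  ext_inner A fun z => by simp [mul_assoc]

theorem smul_comm' (a : A) (c : ℂ) (x : E) : a • c • x = c • a • x :=
  ext_inner A fun z => by simp [mul_smul_comm]

theorem smul_assoc' (c : ℂ) (a : A) (x : E) : (c • a) • x = c • a • x :=
  ext_inner A fun z => by simp [smul_mul_assoc]

theorem norm_smul_le' (a : A) (x : E) : ‖a • x‖ ≤ ‖a‖ * ‖x‖ := by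
  refine (sq_le_sq₀ (norm_nonneg _) (by positivity)).mp ?_
  calc ‖a • x‖ ^ 2 = ‖a * inner A x x * star a‖ := by
        rw [CStarModule.norm_sq_eq A]; simp [mul_assoc]
    _ ≤ ‖a‖ * ‖inner A x x‖ * ‖star a‖ := by
        refine (norm_mul_le _ _).trans ?_
        gcongr
        exact norm_mul_le _ _
    _ = (‖a‖ * ‖x‖) ^ 2 := by rw [← CStarModule.norm_sq_eq A, norm_star]; ring

end Basic

section Adjointable

variable (A E : Type*) [NonUnitalCommCStarAlgebra A] [PartialOrder A] [StarOrderedRing A]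
  [SMul A E] [NormedAddCommGroup E] [NormedSpace ℂ E] [CStarModule A E]

/-- The adjointable operators on the Hilbert `A`-module `E`, as a subalgebra of
the bounded operators. -/
def adjointableSubalgebra : Subalgebra ℂ (E →L[ℂ] E) where
  carrier := {T | ∃ S : E →L[ℂ] E, ∀ x y, inner A (T x) y = inner A x (S y)}
  mul_mem' := by
    rintro T₁ T₂ ⟨S₁, h₁⟩ ⟨S₂, h₂⟩
    exact ⟨S₂ * S₁, fun x y => by simp [h₁, h₂]⟩
  add_mem' := by
    rintro T₁ T₂ ⟨S₁, h₁⟩ ⟨S₂, h₂⟩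
    exact ⟨S₁ + S₂, fun x y => by simp [h₁, h₂]⟩
  algebraMap_mem' c :=
    ⟨algebraMap ℂ (E →L[ℂ] E) (star c), fun x y => by simp [Algebra.algebraMap_eq_smul_one]⟩

/-- The algebra `𝓛(E)` of adjointable operators on `E`, with the operator norm. -/
def Adjointable : Type _ := adjointableSubalgebra A E

instance instNormedRingAdjointable : NormedRing (Adjointable A E) :=
  inferInstanceAs (NormedRing (adjointableSubalgebra A E))

instance instNormedAlgebraAdjointable : NormedAlgebra ℂ (Adjointable A E) :=
  inferInstanceAs (NormedAlgebra ℂ (adjointableSubalgebra A E))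

variable {A E} in
/-- The adjointable operator `T` with adjoint `S`. -/
def Adjointable.mk (T S : E →L[ℂ] E) (h : ∀ x y, inner A (T x) y = inner A x (S y)) :
    Adjointable A E := ⟨T, S, h⟩

variable {A E}

instance instFunLikeAdjointable : FunLike (Adjointable A E) E E where
  coe T := T.1
  coe_injective _ _ h := Subtype.ext (DFunLike.coe_injective h)

@[simp] theorem Adjointable.mk_apply (T S : E →L[ℂ] E)
    (h : ∀ x y, inner A (T x) y = inner A x (S y)) (x : E) : Adjointable.mk T S h x = T x := rfl

@[ext] theorem Adjointable.ext {T S : Adjointable A E} (h : ∀ x, T x = S x) : T = S :=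
  DFunLike.ext _ _ h

@[simp] theorem Adjointable.zero_apply (x : E) : (0 : Adjointable A E) x = 0 := rfl

@[simp] theorem Adjointable.add_apply (T S : Adjointable A E) (x : E) :
    (T + S) x = T x + S x := rfl

@[simp] theorem Adjointable.mul_apply (T S : Adjointable A E) (x : E) :
    (T * S) x = T (S x) := rfl

@[simp] theorem Adjointable.smul_apply (c : ℂ) (T : Adjointable A E) (x : E) :
    (c • T) x = c • T x := rfl

theorem Adjointable.norm_apply_le (T : Adjointable A E) (x : E) : ‖T x‖ ≤ ‖T‖ * ‖x‖ :=
  T.1.le_opNorm x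

/-- The adjoint of an adjointable operator. -/
instance instStarAdjointable : Star (Adjointable A E) where
  star T := ⟨T.2.choose, T.1, fun x y => by
    rw [← CStarModule.star_inner, ← T.2.choose_spec, CStarModule.star_inner]⟩

theorem inner_apply_left (T : Adjointable A E) (x y : E) :
    inner A (T x) y = inner A x (star T y) := T.2.choose_spec x y

theorem inner_apply_right (T : Adjointable A E) (x y : E) :
    inner A x (T y) = inner A (star T x) y := by
  rw [← CStarModule.star_inner, inner_apply_left, CStarModule.star_inner]

theorem eq_star_of_inner {T S : Adjointable A E}
    (h : ∀ x y, inner A (T x) y = inner A x (S y)) : star T = S :=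
  Adjointable.ext fun y => ext_inner A fun x => by
    rw [← inner_apply_left, h]

instance instStarRingAdjointable : StarRing (Adjointable A E) where
  star_involutive T := eq_star_of_inner fun x y => (inner_apply_right T x y).symm
  star_mul S T := eq_star_of_inner fun x y => by
    simp [← inner_apply_left]
  star_add S T := eq_star_of_inner fun x y => by
    simp [← inner_apply_left]

instance instStarModuleAdjointable : StarModule ℂ (Adjointable A E) where
  star_smul c T := eq_star_of_inner fun x y => by
    simp [← inner_apply_left]

theorem norm_star_le (T : Adjointable A E) : ‖star T‖ ≤ ‖T‖ := by
  refine ContinuousLinearMap.opNorm_le_bound _ (norm_nonneg T) fun y => ?_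
  change ‖star T y‖ ≤ ‖T‖ * ‖y‖
  rcases eq_or_ne (star T y) 0 with h | h
  · rw [h, norm_zero]; positivity
  refine le_of_mul_le_mul_right ?_ (norm_pos_iff.mpr h)
  calc ‖star T y‖ * ‖star T y‖ = ‖inner A (T (star T y)) y‖ := by
        rw [← sq, CStarModule.norm_sq_eq A, inner_apply_left T (star T y) y]
    _ ≤ ‖T (star T y)‖ * ‖y‖ := CStarModule.norm_inner_le E
    _ ≤ ‖T‖ * ‖star T y‖ * ‖y‖ := by
        gcongr
        exact T.norm_apply_le _
    _ = ‖T‖ * ‖y‖ * ‖star T y‖ := by ring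

instance instNormedStarGroupAdjointable : NormedStarGroup (Adjointable A E) where
  norm_star_le := norm_star_le

variable (E) in
/-- Multiplication by `a`, as a bounded operator. -/
def mulCLM (a : A) : E →L[ℂ] E :=
  LinearMap.mkContinuous
    { toFun := fun x => a • x
      map_add' := smul_add' a
      map_smul' := fun c x => smul_comm' a c x } ‖a‖ (norm_smul_le' a)

@[simp] theorem mulCLM_apply (a : A) (x : E) : mulCLM E a x = a • x := rfl

theorem inner_smul_left_star (a : A) (x y : E) : inner A (a • x) y = inner A x (star a • y) := by
  simp [mul_comm]

variable (A E) in
/-- The `*`-homomorphism `ι : A → 𝓛(E)`, `ι(a) ξ = ξ · a`, regarding elements of the commutative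
algebra `A` as operators on `E`. -/
def iota : A →⋆ₙₐ[ℂ] Adjointable A E where
  toFun a := .mk (mulCLM E a) (mulCLM E (star a)) (inner_smul_left_star a)
  map_smul' c a := Adjointable.ext fun x => smul_assoc' c a x
  map_zero' := Adjointable.ext fun x => ext_inner A fun z => by simp
  map_add' a b := Adjointable.ext fun x => add_smul' a b x
  map_mul' a b := Adjointable.ext fun x => mul_smul' a b x
  map_star' a := (eq_star_of_inner
    (T := .mk (mulCLM E a) (mulCLM E (star a)) (inner_smul_left_star a))
    (S := .mk (mulCLM E (star a)) (mulCLM E (star (star a))) (inner_smul_left_star (star a)))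
    (inner_smul_left_star a)).symm

@[simp] theorem iota_apply (a : A) (x : E) : iota A E a x = a • x := rfl

variable (A) in
/-- The rank-one operator `θ_{ξ,η} : ζ ↦ ξ · ⟨η, ζ⟩`. -/
def rankOne (ξ η : E) : Adjointable A E :=
  .mk (LinearMap.mkContinuous
      { toFun := fun ζ => inner A η ζ • ξ
        map_add' := fun x y => by rw [CStarModule.inner_add_right, add_smul']
        map_smul' := fun c x => by
          rw [CStarModule.inner_smul_right_complex, smul_assoc', RingHom.id_apply] }
      (‖η‖ * ‖ξ‖) (fun ζ => (norm_smul_le' _ _).trans <| by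
        calc ‖inner A η ζ‖ * ‖ξ‖ ≤ (‖η‖ * ‖ζ‖) * ‖ξ‖ := by
              gcongr; exact CStarModule.norm_inner_le E
          _ = ‖η‖ * ‖ξ‖ * ‖ζ‖ := by ring))
    (LinearMap.mkContinuous
      { toFun := fun ζ => inner A ξ ζ • η
        map_add' := fun x y => by rw [CStarModule.inner_add_right, add_smul']
        map_smul' := fun c x => by
          rw [CStarModule.inner_smul_right_complex, smul_assoc', RingHom.id_apply] }
      (‖ξ‖ * ‖η‖) (fun ζ => (norm_smul_le' _ _).trans <| by
        calc ‖inner A ξ ζ‖ * ‖η‖ ≤ (‖ξ‖ * ‖ζ‖) * ‖η‖ := by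
              gcongr; exact CStarModule.norm_inner_le E
          _ = ‖ξ‖ * ‖η‖ * ‖ζ‖ := by ring))
    fun x y => by simp [mul_comm]

@[simp] theorem rankOne_apply (ξ η ζ : E) : rankOne A ξ η ζ = inner A η ζ • ξ := rfl

variable (A E) in
/-- The compact operators `𝓚(E)`: the closed linear span of the rank-one operators. -/
def compacts : Submodule ℂ (Adjointable A E) :=
  (Submodule.span ℂ {T | ∃ ξ η : E, T = rankOne A ξ η}).topologicalClosure

variable (A E) in
/-- `E` is full: the linear span of the inner products is dense in `A`. -/
def IsFull : Prop :=
  Dense (Submodule.span ℂ {a : A | ∃ ξ η : E, a = inner A ξ η} : Set A)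

end Adjointable

/-! ### Restriction to compact sets -/

section Restriction

variable {X : Type*} [TopologicalSpace X] [LocallyCompactSpace X] [T2Space X]

/-- The restriction of a function in `C₀(X)` to a compact set. -/
def restrictC (K : Compacts X) (f : C₀(X, ℂ)) : C(K, ℂ) := (f : C(X, ℂ)).restrict K

@[simp] theorem restrictC_apply (K : Compacts X) (f : C₀(X, ℂ)) (x : K) :
    restrictC K f x = f x := rfl

/-- The restriction map `C₀(X) → C(K)` is onto. -/
theorem restrictC_surjective (K : Compacts X) : Function.Surjective (restrictC K) := by
  intro c
  let e : K → OnePoint X := fun x => ((x : X) : OnePoint X)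
  have he : Topology.IsClosedEmbedding e :=
    (OnePoint.continuous_coe.comp continuous_subtype_val).isClosedEmbedding
      (OnePoint.coe_injective.comp Subtype.val_injective)
  obtain ⟨g, hg⟩ := c.exists_extension' he
  obtain ⟨b, hb1, -, hbc, -⟩ := exists_continuous_one_zero_of_isCompact K.isCompact
    isClosed_empty (Set.disjoint_empty _)
  let h : C(X, ℂ) :=
    ⟨fun x => (b x : ℂ) * g (x : OnePoint X), by
      have h1 := g.continuous.comp (OnePoint.continuous_coe (X := X))
      have h2 := b.continuous
      exact (Complex.continuous_ofReal.comp h2).mul h1⟩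
  have hc : HasCompactSupport h := by
    refine HasCompactSupport.mul_right (f := fun x => (b x : ℂ)) ?_
    exact hbc.comp_left Complex.ofReal_zero
  refine ⟨⟨h, hc.is_zero_at_infty⟩, ?_⟩
  ext x
  have h1 : b (x : X) = 1 := hb1 x.2
  have h2 : g ((x : X) : OnePoint X) = c x := congrFun hg x
  change ((b (x : X) : ℝ) : ℂ) * g ((x : X) : OnePoint X) = c x
  rw [h1, h2, Complex.ofReal_one, one_mul]

variable (E : Type*) [SMul C₀(X, ℂ) E] [NormedAddCommGroup E] [NormedSpace ℂ E]
  [CStarModule C₀(X, ℂ) E]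

/-- The elements of `E` whose inner products with all elements of `E` vanish on `K`
(equivalently, those `ξ` with `⟨ξ, ξ⟩ = 0` on `K`). -/
def vanishing (K : Compacts X) : Submodule ℂ E where
  carrier := {ξ | ∀ η : E, ∀ x ∈ K, inner C₀(X, ℂ) η ξ x = 0}
  add_mem' h₁ h₂ η x hx := by simp [h₁ η x hx, h₂ η x hx]
  zero_mem' η x _ := by simp
  smul_mem' c ξ h η x hx := by simp [h η x hx]

/-- The restriction `E_K` of the Hilbert `C₀(X)`-module `E` to the compact set `K`. -/
def Restriction (K : Compacts X) : Type _ := E ⧸ vanishing E K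

instance (K : Compacts X) : AddCommGroup (Restriction E K) :=
  inferInstanceAs (AddCommGroup (E ⧸ vanishing E K))

variable {E}

/-- The class in `E_K` of an element of `E`. -/
def Restriction.mk (K : Compacts X) (ξ : E) : Restriction E K :=
  Submodule.Quotient.mk (p := vanishing E K) ξ

theorem Restriction.mk_surjective (K : Compacts X) :
    Function.Surjective (Restriction.mk K : E → Restriction E K) :=
  Submodule.Quotient.mk_surjective _

theorem Restriction.mk_eq_iff {K : Compacts X} {ξ ξ' : E} :
    Restriction.mk K ξ = Restriction.mk K ξ' ↔
      ∀ η : E, ∀ x ∈ K, inner C₀(X, ℂ) η ξ x = inner C₀(X, ℂ) η ξ' x := by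
  refine (Submodule.Quotient.eq (vanishing E K)).trans ?_
  refine forall_congr' fun η => forall_congr' fun x => forall_congr' fun _ => ?_
  simp [sub_eq_zero]

theorem Restriction.mk_add (K : Compacts X) (ξ ξ' : E) :
    Restriction.mk K (ξ + ξ') = Restriction.mk K ξ + Restriction.mk K ξ' := rfl

/-- `C(K)` acts on `E_K` by `f|_K · [ξ] = [f · ξ]`. -/
instance (K : Compacts X) : SMul C(K, ℂ) (Restriction E K) where
  smul c := (vanishing E K).mapQ (vanishing E K)
    (mulCLM E ((restrictC_surjective K c).choose)).toLinearMap (fun ξ h η x hx => by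
      simp [h η x hx])

theorem Restriction.restrictC_smul_mk (K : Compacts X) (f : C₀(X, ℂ)) (ξ : E) :
    restrictC K f • Restriction.mk K ξ = Restriction.mk K (f • ξ) := by
  change Restriction.mk K ((restrictC_surjective K (restrictC K f)).choose • ξ) = _
  refine Restriction.mk_eq_iff.mpr fun η x hx => ?_
  have h := DFunLike.congr_fun (restrictC_surjective K (restrictC K f)).choose_spec ⟨x, hx⟩
  simp only [restrictC_apply] at h
  simp [h]

instance (K : Compacts X) : Module C(K, ℂ) (Restriction E K) where
  one_smul m := by
    obtain ⟨ξ, rfl⟩ := Restriction.mk_surjective K m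
    obtain ⟨f, hf⟩ := restrictC_surjective K 1
    rw [← hf, Restriction.restrictC_smul_mk]
    refine Restriction.mk_eq_iff.mpr fun η x hx => ?_
    have h := DFunLike.congr_fun hf ⟨x, hx⟩
    simp only [restrictC_apply, ContinuousMap.one_apply] at h
    simp [h]
  mul_smul c d m := by
    obtain ⟨ξ, rfl⟩ := Restriction.mk_surjective K m
    obtain ⟨f, rfl⟩ := restrictC_surjective K c
    obtain ⟨g, rfl⟩ := restrictC_surjective K d
    have h : restrictC K f * restrictC K g = restrictC K (f * g) := rfl
    rw [h]
    simp only [Restriction.restrictC_smul_mk, mul_smul']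
  smul_zero c := map_zero ((vanishing E K).mapQ (vanishing E K) _ _)
  smul_add c m m' := map_add ((vanishing E K).mapQ (vanishing E K) _ _) m m'
  add_smul c d m := by
    obtain ⟨ξ, rfl⟩ := Restriction.mk_surjective K m
    obtain ⟨f, rfl⟩ := restrictC_surjective K c
    obtain ⟨g, rfl⟩ := restrictC_surjective K d
    have h : restrictC K f + restrictC K g = restrictC K (f + g) := rfl
    rw [h]
    simp only [Restriction.restrictC_smul_mk, add_smul', Restriction.mk_add]
  zero_smul m := by
    obtain ⟨ξ, rfl⟩ := Restriction.mk_surjective K m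
    have h : (0 : C(K, ℂ)) = restrictC K 0 := rfl
    rw [h, Restriction.restrictC_smul_mk]
    exact Restriction.mk_eq_iff.mpr fun η x hx => by
      simp

variable (X E) in
/-- `E` is σ-finitely generated and σ-projective: its restriction to every compact subset `K` of
`X` is a finitely generated projective `C(K)`-module. -/
def IsSigmaFGProjective : Prop :=
  ∀ K : Compacts X,
    Module.Finite C(K, ℂ) (Restriction E K) ∧ Module.Projective C(K, ℂ) (Restriction E K)

end Restriction

end HilbertModule

/-! ### Correspondences

A C⋆-correspondence from `B` to `A` is a Hilbert `A`-module `E` with a `*`-homomorphism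
`φ : B → 𝓛(E)`. -/

namespace Correspondence

open HilbertModule

variable {A B E : Type*} [NonUnitalCommCStarAlgebra A] [PartialOrder A] [StarOrderedRing A]
  [NonUnitalCommCStarAlgebra B]
  [SMul A E] [NormedAddCommGroup E] [NormedSpace ℂ E] [CStarModule A E]

/-- The left action takes values in the compact operators. -/
def IsProper (φ : B →⋆ₙₐ[ℂ] Adjointable A E) : Prop :=
  ∀ g, φ g ∈ compacts A E

/-- The linear span of `φ(B) E` is dense in `E`. -/
def IsNondegenerate (φ : B →⋆ₙₐ[ℂ] Adjointable A E) : Prop :=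
  Dense (Submodule.span ℂ {ξ : E | ∃ (g : B) (η : E), ξ = φ g η} : Set E)

/-- The C⋆-algebra `D = C*(im ι, im φ)` generated by the images of `ι` and `φ`. -/
def generatedAlgebra (φ : B →⋆ₙₐ[ℂ] Adjointable A E) :
    NonUnitalStarSubalgebra ℂ (Adjointable A E) :=
  (NonUnitalStarAlgebra.adjoin ℂ
    (Set.range (iota A E) ∪ Set.range φ)).topologicalClosure

/-- `ι` as a `*`-homomorphism into `D`. -/
def iotaD (φ : B →⋆ₙₐ[ℂ] Adjointable A E) :
    A →⋆ₙₐ[ℂ] generatedAlgebra φ :=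
  NonUnitalStarAlgHom.codRestrict (iota A E) (generatedAlgebra φ) fun f =>
    NonUnitalStarSubalgebra.le_topologicalClosure _
      (NonUnitalStarAlgebra.subset_adjoin ℂ _ (Or.inl ⟨f, rfl⟩))

/-- `φ` as a `*`-homomorphism into `D`. -/
def phiD (φ : B →⋆ₙₐ[ℂ] Adjointable A E) :
    B →⋆ₙₐ[ℂ] generatedAlgebra φ :=
  NonUnitalStarAlgHom.codRestrict φ (generatedAlgebra φ) fun g =>
    NonUnitalStarSubalgebra.le_topologicalClosure _
      (NonUnitalStarAlgebra.subset_adjoin ℂ _ (Or.inr ⟨g, rfl⟩))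

@[simp] theorem coe_iotaD (φ : B →⋆ₙₐ[ℂ] Adjointable A E) (f : A) :
    (iotaD φ f : Adjointable A E) = iota A E f := rfl

@[simp] theorem coe_phiD (φ : B →⋆ₙₐ[ℂ] Adjointable A E) (g : B) :
    (phiD φ g : Adjointable A E) = φ g := rfl

/-- The Gelfand dual `D̂` of `D = C*(im ι, im φ)`: the space of characters. -/
abbrev Spec (φ : B →⋆ₙₐ[ℂ] Adjointable A E) : Type _ :=
  WeakDual.characterSpace ℂ (generatedAlgebra φ)

/-- An isomorphism `D_E ≅ D_F` compatible with `ι` and `φ`. -/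
def Intertwines {F : Type*} [SMul A F] [NormedAddCommGroup F] [NormedSpace ℂ F]
    [CStarModule A F]
    {φE : B →⋆ₙₐ[ℂ] Adjointable A E}
    {φF : B →⋆ₙₐ[ℂ] Adjointable A F}
    (Φ : generatedAlgebra φE ≃⋆ₐ[ℂ] generatedAlgebra φF) : Prop :=
  (∀ f, Φ (iotaD φE f) = iotaD φF f) ∧ ∀ g, Φ (phiD φE g) = phiD φF g

end Correspondence

/-- `s` is the Gelfand dual of the `*`-homomorphism `ψ : C₀(X) → B` into a commutative C⋆-algebra:
the proper continuous map from the characters of `B` to `X` with `χ ∘ ψ = ev_{s(χ)}`. -/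
structure IsGelfandDual {X B : Type*} [TopologicalSpace X] [NonUnitalNormedRing B] [StarRing B]
    [NormedSpace ℂ B] (ψ : C₀(X, ℂ) →⋆ₙₐ[ℂ] B) (s : WeakDual.characterSpace ℂ B → X) :
    Prop where
  proper : IsProperMap s
  apply_eq : ∀ (χ : WeakDual.characterSpace ℂ B) (f : C₀(X, ℂ)), χ (ψ f) = f (s χ)

/-- The Gelfand dual is unique: `χ ∘ ψ = ev_{s(χ)}` determines the point `s(χ)`. -/
theorem IsGelfandDual.unique {X B : Type*} [TopologicalSpace X] [LocallyCompactSpace X] [T2Space X]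
    [NonUnitalNormedRing B] [StarRing B] [NormedSpace ℂ B] {ψ : C₀(X, ℂ) →⋆ₙₐ[ℂ] B}
    {s t : WeakDual.characterSpace ℂ B → X} (hs : IsGelfandDual ψ s) (ht : IsGelfandDual ψ t) :
    s = t := by
  funext χ
  by_contra h
  obtain ⟨b, hb1, hb0, hbc, -⟩ := exists_continuous_one_zero_of_isCompact
    (isCompact_singleton (x := s χ)) (isClosed_singleton (x := t χ)) (by simpa using h)
  let g : C(X, ℂ) := ⟨fun x => (b x : ℂ), Complex.continuous_ofReal.comp b.continuous⟩
  have hg : HasCompactSupport g := hbc.comp_left Complex.ofReal_zero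
  let f : C₀(X, ℂ) := ⟨g, hg.is_zero_at_infty⟩
  have h1 : f (s χ) = f (t χ) := (hs.apply_eq χ f).symm.trans (ht.apply_eq χ f)
  have h2 : ((b (s χ) : ℝ) : ℂ) = ((b (t χ) : ℝ) : ℂ) := h1
  rw [hb1 rfl, hb0 rfl] at h2
  simp at h2

end

open HilbertModule Correspondence

/-! A character $\chi$ of $D_{\mathcal E}$ is continuous and multiplicative, so it is determined by
its values on the generators $\iota(f)$ and $\varphi(g)$, that is, by the pair $(s(\chi), r(\chi))
\in X \times Y$. Thus $\widehat D_{\mathcal E}$ is identified with a subset of $X \times Y$ whose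
slice over $x$ is $r(s^{-1}(x))$, and condition (2) says that $\mathcal E$ and $\mathcal F$ give the
same subset.

An isomorphism as in (1) pulls characters back without changing their pairs, which gives (2).
Conversely, (2) provides for each character of one algebra a character of the other with the same
pair. Since the norm of a commutative C⋆-algebra is the supremum over its characters, such a map of
characters, even one not known to be continuous, is induced by a `*`-homomorphism fixing the
generators (`exists_starHom`). Two of these in opposite directions are mutually inverse, because
homomorphisms out of $D$ are determined on generators (`starHom_ext`); this also gives uniqueness.

The analytic content is the existence of $s$ and $r$: no character of $D$ may vanish on all of
$\operatorname{im}\iota$ or on all of $\operatorname{im}\varphi$. For $\iota$ this follows from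
properness, since $\iota(e)T \to T$ in norm for compact $T$ along an approximate unit
(`exists_apply_iotaD_ne_zero`). For $\varphi$, nondegeneracy gives $\varphi(e) \to 1$ only strongly;
finite generation over the support of $f$ upgrades this to $\iota(f)\varphi(e) \to \iota(f)$ in norm
(`exists_norm_iota_mul_le`, `exists_apply_phiD_ne_zero`). -/

open Filter Topology

set_option linter.unusedSectionVars false

/-! ### Characters of non-unital C⋆-algebras -/

namespace WeakDual.CharacterSpace

section NonUnitalCStarAlgebra

variable {B : Type*} [NonUnitalCStarAlgebra B]

/-- The extension of a character to the unitization. -/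
noncomputable def unitizationLift (χ : characterSpace ℂ B) : Unitization ℂ B →ₐ[ℂ] ℂ :=
  Unitization.lift (toNonUnitalAlgHom χ)

@[simp] theorem unitizationLift_inr (χ : characterSpace ℂ B) (a : B) :
    unitizationLift χ a = χ a := by
  simp [unitizationLift]

theorem map_star_of_nonUnital (χ : characterSpace ℂ B) (a : B) : χ (star a) = star (χ a) := by
  have := WeakDual.Complex.instStarHomClass.map_star (unitizationLift χ) (a : Unitization ℂ B)
  rwa [← Unitization.inr_star, unitizationLift_inr, unitizationLift_inr] at this

theorem norm_apply_le_norm (χ : characterSpace ℂ B) (a : B) : ‖χ a‖ ≤ ‖a‖ := by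
  have := AlgHom.norm_apply_le_self (unitizationLift χ) (a : Unitization ℂ B)
  rwa [unitizationLift_inr, Unitization.norm_inr] at this

/-- A nonzero multiplicative functional is a character. -/
noncomputable def ofNonUnitalAlgHom (ψ : B →ₙₐ[ℂ] ℂ) (hψ : Continuous ψ) (h : ∃ a, ψ a ≠ 0) :
    characterSpace ℂ B :=
  ⟨(⟨{ toFun := ψ, map_add' := map_add ψ, map_smul' := map_smul ψ }, hψ⟩ : B →L[ℂ] ℂ),
    fun h0 => by
      obtain ⟨a, ha⟩ := h
      exact ha (DFunLike.congr_fun h0 a), map_mul ψ⟩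

end NonUnitalCStarAlgebra

section NonUnitalCommCStarAlgebra

variable {B : Type*} [NonUnitalCommCStarAlgebra B]

/-- The Gelfand transform of the unitization is isometric, and each character of the unitization
either restricts to a character of `B` or kills `B`. -/
theorem norm_le_of_forall_norm_apply_le {a : B} {C : ℝ} (hC : 0 ≤ C)
    (h : ∀ χ : characterSpace ℂ B, ‖χ a‖ ≤ C) : ‖a‖ ≤ C := by
  rw [← Unitization.norm_inr (𝕜 := ℂ) a,
    ← (gelfandTransform_isometry (Unitization ℂ B)).norm_map_of_map_zero (map_zero _),
    ContinuousMap.norm_le _ hC]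
  intro χ
  change ‖χ (a : Unitization ℂ B)‖ ≤ C
  by_cases h0 : ∃ b : B, χ (b : Unitization ℂ B) ≠ 0
  · refine h (ofNonUnitalAlgHom ((toNonUnitalAlgHom χ).comp (Unitization.inrNonUnitalAlgHom ℂ B))
      ?_ h0)
    exact (map_continuous χ).comp (Unitization.isometry_inr (𝕜 := ℂ)).continuous
  · push Not at h0
    simpa [h0 a] using hC

theorem eq_of_forall_apply_eq {a b : B} (h : ∀ χ : characterSpace ℂ B, χ a = χ b) : a = b := by
  rw [← sub_eq_zero, ← norm_le_zero_iff]
  exact norm_le_of_forall_norm_apply_le le_rfl fun χ => by simp [map_sub, h χ]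

end NonUnitalCommCStarAlgebra

end WeakDual.CharacterSpace

open WeakDual

/-! ### Characters of `C₀(X)` and existence of Gelfand duals -/

namespace ZeroAtInftyContinuousMap

variable {X : Type*} [TopologicalSpace X] [LocallyCompactSpace X] [T2Space X]

/-- The extension by zero to the one-point compactification. -/
noncomputable def extendOnePoint (f : C₀(X, ℂ)) : C(OnePoint X, ℂ) :=
  OnePoint.continuousMapMk f 0 (by simpa using zero_at_infty f)

/-- The product of a function on the one-point compactification with one vanishing at infinity. -/
noncomputable def onePointMul (F : C(OnePoint X, ℂ)) (h : C₀(X, ℂ)) : C₀(X, ℂ) where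
  toFun x := F x * h x
  continuous_toFun := (F.continuous.comp OnePoint.continuous_coe).mul (map_continuous h)
  zero_at_infty' := by
    refine isBoundedUnder_le_mul_tendsto_zero ?_ (zero_at_infty h)
    exact isBoundedUnder_of ⟨‖F‖, fun x => F.norm_coe_le_norm x⟩

/-- A nonzero multiplicative functional on `C₀(X)` is the evaluation at a point. -/
theorem exists_eq_eval (ψ : C₀(X, ℂ) →ₙₐ[ℂ] ℂ) (hψ : ∃ f, ψ f ≠ 0) : ∃ x, ∀ f, ψ f = f x := by
  obtain ⟨h, hh⟩ := hψ
  -- Since `C₀(X)` is an ideal in `C(OnePoint X)`, the formula `F ↦ ψ (F h) / ψ h` extends `ψ` to a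
  -- unital character, which is an evaluation by compactness.
  let Ψ : C(OnePoint X, ℂ) →ₐ[ℂ] ℂ := AlgHom.ofLinearMap
    { toFun F := ψ (onePointMul F h) / ψ h
      map_add' F G := by
        rw [← add_div, ← map_add]
        congr 2
        ext x
        exact add_mul _ _ _
      map_smul' c F := by
        rw [RingHom.id_apply, smul_eq_mul, ← mul_div_assoc, ← smul_eq_mul, ← map_smul]
        congr 2
        ext x
        exact mul_assoc _ _ _ }
    (by
      have : onePointMul 1 h = h := by ext x; exact one_mul _
      simp [this, hh])
    (fun F G => by
      have : onePointMul (F * G) h * h = onePointMul F h * onePointMul G h := by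
        ext x
        refine (mul_assoc _ _ _).trans ?_
        exact mul_mul_mul_comm (F x) (G x) (h x) (h x)
      have := congrArg ψ this
      rw [map_mul, map_mul] at this
      simp only [LinearMap.coe_mk, AddHom.coe_mk]
      field_simp
      exact this)
  obtain ⟨p, hp⟩ := (CharacterSpace.continuousMapEval_bijective (X := OnePoint X) (𝕜 := ℂ)).2
    (CharacterSpace.equivAlgHom.symm Ψ)
  have key (f : C₀(X, ℂ)) : ψ f = extendOnePoint f p := by
    have h1 : onePointMul (extendOnePoint f) h = f * h := by ext x; rfl
    have h2 : Ψ (extendOnePoint f) = extendOnePoint f p :=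
      (DFunLike.congr_fun hp (extendOnePoint f)).symm
    rw [← h2]
    change _ = ψ (onePointMul (extendOnePoint f) h) / ψ h
    rw [h1, map_mul, mul_div_cancel_right₀ _ hh]
  induction p using OnePoint.rec with
  -- Evaluation at infinity kills `h`, whereas `ψ h ≠ 0`.
  | infty => exact absurd (key h) hh
  | coe x => exact ⟨x, key⟩

/-- A bump function in `C₀(X)`. -/
theorem exists_one_of_isCompact {K U : Set X} (hK : IsCompact K) (hU : IsOpen U) (hKU : K ⊆ U) :
    ∃ f : C₀(X, ℂ), (∀ x ∈ K, f x = 1) ∧ (∀ x ∉ U, f x = 0) ∧ HasCompactSupport f := by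
  obtain ⟨b, hb1, hb0, hbc, -⟩ := exists_continuous_one_zero_of_isCompact hK hU.isClosed_compl
    (Set.disjoint_compl_right_iff_subset.mpr hKU)
  let g : C(X, ℂ) := ⟨fun x => (b x : ℂ), Complex.continuous_ofReal.comp b.continuous⟩
  have hg : HasCompactSupport g := hbc.comp_left Complex.ofReal_zero
  refine ⟨⟨g, hg.is_zero_at_infty⟩, fun x hx => ?_, fun x hx => ?_, hg⟩
  · change ((b x : ℝ) : ℂ) = 1
    rw [hb1 hx, Pi.one_apply, Complex.ofReal_one]
  · change ((b x : ℝ) : ℂ) = 0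
    rw [hb0 hx, Pi.zero_apply, Complex.ofReal_zero]

/-- Functions in `C₀(X)` separate points. -/
theorem eq_of_forall_apply_eq {x y : X} (h : ∀ f : C₀(X, ℂ), f x = f y) : x = y := by
  by_contra hxy
  obtain ⟨f, hf1, hf0, -⟩ := exists_one_of_isCompact (isCompact_singleton (x := x))
    (isOpen_compl_singleton (x := y)) (by simpa using Ne.symm hxy)
  simpa [hf1, hf0] using h f

end ZeroAtInftyContinuousMap

open ZeroAtInftyContinuousMap

/-- The characters with a given nonzero value at a given element form a compact set. -/
theorem WeakDual.CharacterSpace.isCompact_apply_eq {B : Type*} [NonUnitalCStarAlgebra B] (b : B)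
    {z : ℂ} (hz : z ≠ 0) : IsCompact {χ : characterSpace ℂ B | χ b = z} := by
  rw [Subtype.isCompact_iff]
  have h1 : Subtype.val '' {χ : characterSpace ℂ B | χ b = z} =
      (characterSpace ℂ B ∪ {0}) ∩ {χ : WeakDual ℂ B | χ b = z} := by
    ext χ
    constructor
    · rintro ⟨χ, hχ, rfl⟩
      exact ⟨Or.inl χ.2, hχ⟩
    · rintro ⟨hχ | hχ, h⟩
      · exact ⟨⟨χ, hχ⟩, h, rfl⟩
      · rw [Set.mem_singleton_iff.mp hχ] at h
        exact absurd h.symm hz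
  rw [h1]
  -- Characters are weak-* closed only after adding `0`; the condition `χ b = z` with `z ≠ 0`
  -- removes that point again. Compactness is then Banach–Alaoglu.
  refine (isCompact_closedBall (𝕜 := ℂ) (E := B) 0 1).of_isClosed_subset
    ((CharacterSpace.union_zero_isClosed ℂ B).inter
      (isClosed_eq (eval_continuous b) continuous_const)) ?_
  rw [← h1]
  rintro _ ⟨χ, -, rfl⟩
  rw [Set.mem_preimage, mem_closedBall_zero_iff]
  exact ContinuousLinearMap.opNorm_le_bound _ zero_le_one fun a => by
    simpa using norm_apply_le_norm χ a

/-- A `*`-homomorphism `C₀(X) → B` on whose range no character vanishes has a Gelfand dual. -/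
theorem exists_isGelfandDual {X B : Type*} [TopologicalSpace X] [LocallyCompactSpace X] [T2Space X]
    [NonUnitalCStarAlgebra B] (ψ : C₀(X, ℂ) →⋆ₙₐ[ℂ] B)
    (h : ∀ χ : characterSpace ℂ B, ∃ f, χ (ψ f) ≠ 0) : ∃ s, IsGelfandDual ψ s := by
  choose s hs using fun χ : characterSpace ℂ B => exists_eq_eval
    ((CharacterSpace.toNonUnitalAlgHom χ).comp (ψ : C₀(X, ℂ) →ₙₐ[ℂ] B)) (h χ)
  replace hs : ∀ (χ : characterSpace ℂ B) (f : C₀(X, ℂ)), χ (ψ f) = f (s χ) := hs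
  have hev (b : B) : Continuous fun χ : characterSpace ℂ B => χ b :=
    (eval_continuous b).comp continuous_subtype_val
  have hc : Continuous s := by
    refine continuous_iff_continuousAt.mpr fun χ U hU => ?_
    obtain ⟨V, hVU, hV, hχ⟩ := mem_nhds_iff.mp hU
    obtain ⟨f, hf1, hf0, -⟩ := exists_one_of_isCompact (isCompact_singleton (x := s χ)) hV
      (by simpa using hχ)
    have h1 : {χ' : characterSpace ℂ B | χ' (ψ f) ≠ 0} ∈ 𝓝 χ :=
      (isOpen_ne_fun (hev (ψ f)) continuous_const).mem_nhds (by simp [hs, hf1])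
    refine mem_map.mpr (mem_of_superset h1 fun χ' h' => hVU ?_)
    by_contra hn
    exact h' ((hs χ' f).trans (hf0 _ hn))
  refine ⟨s, isProperMap_iff_isCompact_preimage.mpr ⟨hc, fun K hK => ?_⟩, hs⟩
  obtain ⟨f, hf1, -⟩ := exists_one_of_isCompact hK isOpen_univ (Set.subset_univ K)
  -- As `f = 1` on `K`, the closed set `s ⁻¹' K` lies in the compact set where `χ (ψ f) = 1`.
  exact (CharacterSpace.isCompact_apply_eq (ψ f) one_ne_zero).of_isClosed_subset
    (hK.isClosed.preimage hc) fun χ hχ => (hs χ f).trans (hf1 _ hχ)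

/-! ### The C⋆-algebra of adjointable operators and approximate units -/

namespace HilbertModule

section Adjointable

variable {A E : Type*} [NonUnitalCommCStarAlgebra A] [PartialOrder A] [StarOrderedRing A]
  [SMul A E] [NormedAddCommGroup E] [NormedSpace ℂ E] [CStarModule A E]

theorem inner_self_eq_norm_sq (x : E) : ‖inner A x x‖ = ‖x‖ * ‖x‖ := by
  rw [← sq, CStarModule.norm_sq_eq A]

theorem Adjointable.norm_le_of_bound (T : Adjointable A E) {C : ℝ} (hC : 0 ≤ C)
    (h : ∀ x, ‖T x‖ ≤ C * ‖x‖) : ‖T‖ ≤ C :=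
  ContinuousLinearMap.opNorm_le_bound _ hC h

theorem Adjointable.norm_mul_self_le_norm_star_mul_self (T : Adjointable A E) :
    ‖T‖ * ‖T‖ ≤ ‖star T * T‖ := by
  have h : ‖T‖ ≤ √‖star T * T‖ := by
    refine T.norm_le_of_bound (Real.sqrt_nonneg _) fun x => ?_
    refine (sq_le_sq₀ (norm_nonneg _) (by positivity)).mp ?_
    rw [mul_pow, Real.sq_sqrt (norm_nonneg _), sq, ← inner_self_eq_norm_sq (A := A),
      inner_apply_left]
    calc _ ≤ ‖x‖ * ‖(star T * T) x‖ := CStarModule.norm_inner_le E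
      _ ≤ ‖x‖ * (‖star T * T‖ * ‖x‖) := by
        gcongr
        exact Adjointable.norm_apply_le _ _
      _ = _ := by ring
  simpa using mul_self_le_mul_self (norm_nonneg T) h

/-- The adjoints of a Cauchy sequence are again Cauchy, and by continuity of the inner product the
two limits are adjoint to each other. -/
instance instCompleteSpaceAdjointable [CompleteSpace E] : CompleteSpace (Adjointable A E) := by
  refine Metric.complete_of_cauchySeq_tendsto fun u hu => ?_
  have hu' : CauchySeq fun n => star (u n) := by
    rw [Metric.cauchySeq_iff] at hu ⊢
    simpa only [dist_eq_norm, ← star_sub, norm_star] using hu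
  have hval : Isometry fun T : Adjointable A E => (T.1 : E →L[ℂ] E) := isometry_subtype_coe
  obtain ⟨T, hT⟩ := cauchySeq_tendsto_of_complete (hval.uniformContinuous.comp_cauchySeq hu)
  obtain ⟨S, hS⟩ := cauchySeq_tendsto_of_complete (hval.uniformContinuous.comp_cauchySeq hu')
  have hT' (x : E) : Tendsto (fun n => u n x) atTop (𝓝 (T x)) :=
    ((ContinuousLinearMap.apply ℂ E x).continuous.tendsto T).comp hT
  have hS' (x : E) : Tendsto (fun n => star (u n) x) atTop (𝓝 (S x)) :=
    ((ContinuousLinearMap.apply ℂ E x).continuous.tendsto S).comp hS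
  have key (x y : E) : inner A (T x) y = inner A x (S y) := by
    have h1 : Tendsto (fun n => inner A (u n x) y) atTop (𝓝 (inner A (T x) y)) :=
      (CStarModule.continuous_inner.tendsto (T x, y)).comp ((hT' x).prodMk_nhds tendsto_const_nhds)
    have h2 : Tendsto (fun n => inner A x (star (u n) y)) atTop (𝓝 (inner A x (S y))) :=
      (CStarModule.continuous_inner.tendsto (x, S y)).comp (tendsto_const_nhds.prodMk_nhds (hS' y))
    simp only [← inner_apply_left] at h2
    exact tendsto_nhds_unique h1 h2
  exact ⟨Adjointable.mk T S key, hval.isEmbedding.tendsto_nhds_iff.mpr hT⟩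

namespace CStarInstances

/-- The adjointable operators form a C⋆-algebra. The instance is scoped, so that it does not
interfere with the normed ring structure that `Adjointable` carries already. -/
noncomputable scoped instance instCStarAlgebraAdjointable [CompleteSpace E] : CStarAlgebra (Adjointable A E) where
  norm_mul_self_le := Adjointable.norm_mul_self_le_norm_star_mul_self

end CStarInstances

open scoped CStarInstances

theorem Adjointable.apply_smul (T : Adjointable A E) (a : A) (x : E) : T (a • x) = a • T x :=
  ext_inner A fun z => by simp [inner_apply_right]

theorem iota_mul_comm (a : A) (T : Adjointable A E) : iota A E a * T = T * iota A E a :=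
  Adjointable.ext fun x => by simp [Adjointable.apply_smul]

theorem norm_iota_le (a : A) : ‖iota A E a‖ ≤ ‖a‖ :=
  Adjointable.norm_le_of_bound _ (norm_nonneg a) (norm_smul_le' a)

theorem iota_mul_rankOne (a : A) (ξ η : E) : iota A E a * rankOne A ξ η = rankOne A (a • ξ) η :=
  Adjointable.ext fun x => by simp [← mul_smul', mul_comm]

theorem norm_rankOne_le (ξ η : E) : ‖rankOne A ξ η‖ ≤ ‖ξ‖ * ‖η‖ :=
  Adjointable.norm_le_of_bound _ (by positivity) fun ζ => by
    rw [rankOne_apply]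
    calc _ ≤ ‖inner A η ζ‖ * ‖ξ‖ := norm_smul_le' _ _
      _ ≤ (‖η‖ * ‖ζ‖) * ‖ξ‖ := by gcongr; exact CStarModule.norm_inner_le E
      _ = _ := by ring

/-- Strong convergence to the identity of a net of contractions passes from a set to its closed
linear span. -/
theorem tendsto_of_mem_closure_span {ι V : Type*} [NormedAddCommGroup V] [NormedSpace ℂ V]
    {l : Filter ι} {L : ι → V →L[ℂ] V} (hL : ∀ᶠ i in l, ‖L i‖ ≤ 1) {s : Set V}
    (hs : ∀ v ∈ s, Tendsto (fun i => L i v) l (𝓝 v)) {v : V}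
    (hv : v ∈ closure (Submodule.span ℂ s : Set V)) : Tendsto (fun i => L i v) l (𝓝 v) := by
  have hspan (w : V) (hw : w ∈ Submodule.span ℂ s) : Tendsto (fun i => L i w) l (𝓝 w) := by
    induction hw using Submodule.span_induction with
    | mem w hw => exact hs w hw
    | zero => simpa using tendsto_const_nhds
    | add x y _ _ hx hy => simpa using hx.add hy
    | smul c x _ hx => simpa using hx.const_smul c
  rw [Metric.tendsto_nhds]
  intro ε hε
  obtain ⟨w, hw, hvw⟩ := Metric.mem_closure_iff.mp hv (ε / 3) (by positivity)
  filter_upwards [hL, Metric.tendsto_nhds.mp (hspan w hw) (ε / 3) (by positivity)] with i h1 h2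
  have h3 : dist (L i v) (L i w) ≤ dist v w := by
    rw [dist_eq_norm, dist_eq_norm, ← map_sub]
    exact (L i).le_of_opNorm_le_of_le h1 le_rfl |>.trans_eq (one_mul _)
  have h4 := dist_triangle4 (L i v) (L i w) w v
  rw [dist_comm w v] at h4
  linarith

/-- With `a = ⟨ξ, ξ⟩`, expanding the inner product gives `‖eξ - ξ‖² = ‖(ea - a)e* - (ea - a)‖ ≤ 2‖ea
- a‖`. -/
theorem tendsto_smul_of_approximateUnit {l : Filter A} (hl : l.IsIncreasingApproximateUnit)
    (ξ : E) : Tendsto (fun e => e • ξ) l (𝓝 ξ) := by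
  rw [tendsto_iff_norm_sub_tendsto_zero]
  have h1 : Tendsto (fun e : A => √(‖e * inner A ξ ξ - inner A ξ ξ‖ * 2)) l (𝓝 0) := by
    simpa using ((tendsto_iff_norm_sub_tendsto_zero.mp
      (hl.tendsto_mul_right (inner A ξ ξ))).mul_const 2).sqrt
  refine squeeze_zero' (.of_forall fun _ => norm_nonneg _) ?_ h1
  filter_upwards [hl.eventually_norm] with e he
  refine Real.le_sqrt_of_sq_le ?_
  have h2 : inner A (e • ξ - ξ) (e • ξ - ξ) =
      (e * inner A ξ ξ - inner A ξ ξ) * star e - (e * inner A ξ ξ - inner A ξ ξ) := by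
    simp only [CStarModule.inner_sub_left, CStarModule.inner_sub_right,
      CStarModule.inner_op_smul_right, CStarModule.inner_op_smul_left, sub_mul, mul_sub, mul_assoc]
    abel
  rw [sq, ← inner_self_eq_norm_sq (A := A), h2]
  refine (norm_sub_le _ _).trans ?_
  rw [mul_two]
  gcongr
  refine (norm_mul_le _ _).trans (mul_le_of_le_one_right (norm_nonneg _) ?_)
  rwa [norm_star]

theorem tendsto_iota_mul_of_mem_compacts {l : Filter A} (hl : l.IsIncreasingApproximateUnit)
    {T : Adjointable A E} (hT : T ∈ compacts A E) :
    Tendsto (fun e => iota A E e * T) l (𝓝 T) := by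
  refine tendsto_of_mem_closure_span
    (L := fun e => ContinuousLinearMap.mul ℂ (Adjointable A E) (iota A E e)) ?_ ?_ hT
  · filter_upwards [hl.eventually_norm] with e he
    exact (ContinuousLinearMap.opNorm_mul_apply_le _ _ _).trans ((norm_iota_le e).trans he)
  · rintro _ ⟨ξ, η, rfl⟩
    simp only [ContinuousLinearMap.mul_apply', iota_mul_rankOne]
    rw [tendsto_iff_norm_sub_tendsto_zero]
    have h1 := (tendsto_iff_norm_sub_tendsto_zero.mp
      (tendsto_smul_of_approximateUnit hl ξ)).mul_const ‖η‖
    rw [zero_mul] at h1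
    refine squeeze_zero (fun _ => norm_nonneg _) (fun e => ?_) h1
    have h2 : rankOne A (e • ξ) η - rankOne A ξ η = rankOne A (e • ξ - ξ) η := by
      rw [sub_eq_iff_eq_add]
      ext ζ
      simp [← smul_add']
    rw [h2]
    exact norm_rankOne_le _ _

end Adjointable

end HilbertModule

/-! ### Commutativity of the generated algebra -/

namespace Correspondence

open HilbertModule
open scoped HilbertModule.CStarInstances

variable {A B E : Type*} [NonUnitalCommCStarAlgebra A] [PartialOrder A] [StarOrderedRing A]
  [NonUnitalCommCStarAlgebra B]
  [SMul A E] [NormedAddCommGroup E] [NormedSpace ℂ E] [CStarModule A E]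

theorem isClosed_generatedAlgebra (φ : B →⋆ₙₐ[ℂ] Adjointable A E) :
    IsClosed (generatedAlgebra φ : Set (Adjointable A E)) :=
  NonUnitalStarSubalgebra.isClosed_topologicalClosure _

/-- Adjointable operators are `A`-linear, so `im ι` is central in all of `𝓛(E)`; `im φ` is
commutative because `B` is. -/
theorem generatedAlgebra_mul_comm (φ : B →⋆ₙₐ[ℂ] Adjointable A E) (a b : generatedAlgebra φ) :
    a * b = b * a := by
  have hcomm : ∀ a ∈ Set.range (iota A E) ∪ Set.range φ, ∀ b ∈ Set.range (iota A E) ∪ Set.range φ,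
      a * b = b * a := by
    rintro _ (⟨a, rfl⟩ | ⟨a, rfl⟩) _ (⟨b, rfl⟩ | ⟨b, rfl⟩)
    · exact iota_mul_comm _ _
    · exact iota_mul_comm _ _
    · exact (iota_mul_comm _ _).symm
    · rw [← map_mul, mul_comm, map_mul]
  have hstar : ∀ a ∈ Set.range (iota A E) ∪ Set.range φ,
      star a ∈ Set.range (iota A E) ∪ Set.range φ := by
    rintro _ (⟨a, rfl⟩ | ⟨a, rfl⟩)
    · exact Or.inl ⟨star a, map_star _ _⟩
    · exact Or.inr ⟨star a, map_star _ _⟩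
  have := NonUnitalStarAlgebra.isMulCommutative_adjoin ℂ hcomm
    fun a ha b hb => hcomm a ha _ (hstar b hb)
  exact (NonUnitalStarSubalgebra.nonUnitalCommRingTopologicalClosure _
    fun x y => this.is_comm.comm x y).mul_comm a b

end Correspondence

namespace HilbertModule.CStarInstances

open Correspondence

/-- The C⋆-algebra `C*(im ι, im φ)` is commutative. -/
noncomputable scoped instance instNonUnitalCommCStarAlgebraGeneratedAlgebra
    {A B E : Type*} [NonUnitalCommCStarAlgebra A] [PartialOrder A] [StarOrderedRing A]
    [NonUnitalCommCStarAlgebra B] [SMul A E] [NormedAddCommGroup E] [NormedSpace ℂ E]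
    [CStarModule A E] [CompleteSpace E] (φ : B →⋆ₙₐ[ℂ] Adjointable A E) : NonUnitalCommCStarAlgebra (generatedAlgebra φ) :=
  { NonUnitalStarSubalgebra.nonUnitalCStarAlgebra (generatedAlgebra φ)
      (h_closed := isClosed_generatedAlgebra φ) with
    mul_comm := generatedAlgebra_mul_comm φ }

end HilbertModule.CStarInstances

/-! ### Characters do not vanish along `ι` -/

namespace Correspondence

open HilbertModule
open scoped HilbertModule.CStarInstances

section Nonvanishing

variable {A B E : Type*} [NonUnitalCommCStarAlgebra A] [PartialOrder A] [StarOrderedRing A]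
  [NonUnitalCommCStarAlgebra B]
  [SMul A E] [NormedAddCommGroup E] [NormedSpace ℂ E] [CompleteSpace E] [CStarModule A E]

theorem exists_seq_adjoin_tendsto (φ : B →⋆ₙₐ[ℂ] Adjointable A E) (d : generatedAlgebra φ) :
    ∃ u : ℕ → generatedAlgebra φ, (∀ n, (u n : Adjointable A E) ∈
      NonUnitalStarAlgebra.adjoin ℂ (Set.range (iota A E) ∪ Set.range φ)) ∧
      Tendsto u atTop (𝓝 d) := by
  obtain ⟨v, hv, hvd⟩ := mem_closure_iff_seq_limit.mp d.2
  exact ⟨fun n => ⟨v n, NonUnitalStarSubalgebra.le_topologicalClosure _ (hv n)⟩, hv,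
    tendsto_subtype_rng.mpr hvd⟩

/-- An induction principle for elements of `C*(im ι, im φ)`. -/
theorem generatedAlgebra_induction {φ : B →⋆ₙₐ[ℂ] Adjointable A E}
    {p : generatedAlgebra φ → Prop} (iota : ∀ f, p (iotaD φ f)) (phi : ∀ g, p (phiD φ g))
    (add : ∀ a b, p a → p b → p (a + b)) (zero : p 0) (mul : ∀ a b, p a → p b → p (a * b))
    (smul : ∀ (c : ℂ) a, p a → p (c • a)) (star : ∀ a, p a → p (star a))
    (limit : ∀ (u : ℕ → generatedAlgebra φ) a, (∀ n, p (u n)) → Tendsto u atTop (𝓝 a) → p a)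
    (a : generatedAlgebra φ) : p a := by
  obtain ⟨u, hu, hua⟩ := exists_seq_adjoin_tendsto φ a
  refine limit u a (fun n => ?_) hua
  have hle := NonUnitalStarSubalgebra.le_topologicalClosure
    (NonUnitalStarAlgebra.adjoin ℂ (Set.range (HilbertModule.iota A E) ∪ Set.range φ))
  suffices h : ∀ (T : Adjointable A E) (hT : T ∈ NonUnitalStarAlgebra.adjoin ℂ
      (Set.range (HilbertModule.iota A E) ∪ Set.range φ)), p ⟨T, hle hT⟩ from h _ (hu n)
  intro T hT
  induction hT using NonUnitalStarAlgebra.adjoin_induction with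
  | mem x hx =>
    rcases hx with ⟨f, rfl⟩ | ⟨g, rfl⟩
    · exact iota f
    · exact phi g
  | add x y hx hy h1 h2 => exact add _ _ h1 h2
  | zero => exact zero
  | mul x y hx hy h1 h2 => exact mul _ _ h1 h2
  | smul c x hx h1 => exact smul c _ h1
  | star x hx h1 => exact star _ h1

/-- No character of `C*(im ι, im φ)` vanishes along both `ι` and `φ`. -/
theorem exists_iotaD_or_phiD_ne_zero {φ : B →⋆ₙₐ[ℂ] Adjointable A E} (χ : Spec φ) :
    (∃ f, χ (iotaD φ f) ≠ 0) ∨ ∃ g, χ (phiD φ g) ≠ 0 := by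
  by_contra! h
  refine χ.2.1 (ContinuousLinearMap.ext fun d => ?_)
  change χ d = 0
  induction d using generatedAlgebra_induction with
  | iota f => exact h.1 f
  | phi g => exact h.2 g
  | add a b ha hb => rw [map_add, ha, hb, add_zero]
  | zero => exact map_zero χ
  | mul a b ha hb => rw [map_mul, ha, zero_mul]
  | smul c a ha => rw [map_smul, ha, smul_zero]
  | star a ha => rw [WeakDual.CharacterSpace.map_star_of_nonUnital, ha, star_zero]
  | limit u a hu hua =>
    refine tendsto_nhds_unique (((map_continuous χ).tendsto a).comp hua) ?_
    simp [Function.comp_def, hu]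

/-- A character killing `im ι` would kill each compact operator `φ g`, the norm limit of `ι(e)
φ(g)`, and hence all generators. -/
theorem exists_apply_iotaD_ne_zero {φ : B →⋆ₙₐ[ℂ] Adjointable A E} (hφ : IsProper φ)
    (χ : Spec φ) : ∃ f, χ (iotaD φ f) ≠ 0 := by
  rcases exists_iotaD_or_phiD_ne_zero χ with h | ⟨g, hg⟩
  · exact h
  by_contra! h
  have hl := CStarAlgebra.increasingApproximateUnit A
  have h1 : Tendsto (fun e => iotaD φ e * phiD φ g) (CStarAlgebra.approximateUnit A)
      (𝓝 (phiD φ g)) :=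
    tendsto_subtype_rng.mpr (tendsto_iota_mul_of_mem_compacts hl (hφ g))
  refine hg (tendsto_nhds_unique (((map_continuous χ).tendsto _).comp h1) ?_)
  simp [Function.comp_def, h]

theorem tendsto_apply_of_isNondegenerate [PartialOrder B] [StarOrderedRing B]
    {φ : B →⋆ₙₐ[ℂ] Adjointable A E}
    (hφ : IsNondegenerate φ) {l : Filter B} (hl : l.IsIncreasingApproximateUnit) (ξ : E) :
    Tendsto (fun e => φ e ξ) l (𝓝 ξ) := by
  refine tendsto_of_mem_closure_span (L := fun e => (φ e).1) ?_ ?_ (hφ ξ)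
  · filter_upwards [hl.eventually_norm] with e he
    exact (NonUnitalStarAlgHom.norm_apply_le φ e).trans he
  · rintro _ ⟨g, η, rfl⟩
    have h1 : Continuous fun b : B => φ b η := by
      have : LipschitzWith (Real.toNNReal ‖η‖) fun b : B => φ b η := by
        refine LipschitzWith.of_dist_le_mul fun b c => ?_
        rw [dist_eq_norm, dist_eq_norm, Real.coe_toNNReal _ (norm_nonneg η), mul_comm]
        have : φ b η - φ c η = φ (b - c) η := by
          rw [sub_eq_iff_eq_add, ← Adjointable.add_apply, ← map_add, sub_add_cancel]
        rw [this]
        refine (Adjointable.norm_apply_le _ _).trans ?_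
        gcongr
        exact NonUnitalStarAlgHom.norm_apply_le φ _
      exact this.continuous
    refine ((h1.tendsto g).comp (hl.tendsto_mul_right g)).congr fun e => ?_
    simp only [Function.comp_apply, map_mul, Adjointable.mul_apply]
    rfl

end Nonvanishing

end Correspondence

/-! ### Finite generation over compact sets; characters do not vanish along `φ` -/

namespace ZeroAtInftyContinuousMap

variable {X : Type*} [TopologicalSpace X]

theorem norm_apply_le (f : C₀(X, ℂ)) (x : X) : ‖f x‖ ≤ ‖f‖ :=
  f.toBCF.norm_coe_le_norm x

theorem continuous_eval_const (x : X) : Continuous fun f : C₀(X, ℂ) => f x :=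
  (LipschitzWith.of_dist_le_mul (K := 1) fun f g => by
    simpa using BoundedContinuousFunction.dist_coe_le_dist (f := f.toBCF) (g := g.toBCF) x
    ).continuous

end ZeroAtInftyContinuousMap

namespace HilbertModule

open scoped CStarInstances

variable {X : Type*} [TopologicalSpace X] [LocallyCompactSpace X] [T2Space X]
  {E : Type*} [SMul C₀(X, ℂ) E] [NormedAddCommGroup E] [NormedSpace ℂ E]
  [CStarModule C₀(X, ℂ) E]

theorem isClosed_vanishing (K : Compacts X) : IsClosed (vanishing E K : Set E) := by
  have : (vanishing E K : Set E) = ⋂ η : E, ⋂ x ∈ K, {ξ | inner C₀(X, ℂ) η ξ x = 0} := by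
    ext ξ
    simp [vanishing]
  rw [this]
  refine isClosed_iInter fun η => isClosed_iInter fun x => isClosed_iInter fun _ =>
    isClosed_eq ?_ continuous_const
  exact (ZeroAtInftyContinuousMap.continuous_eval_const x).comp (CStarModule.innerSL (A := C₀(X, ℂ)) η).continuous

/-- A finitely generated restriction is spanned by finitely many elements of the module. -/
theorem exists_generators {K : Compacts X} [Module.Finite C(K, ℂ) (Restriction E K)] :
    ∃ (n : ℕ) (ξ : Fin n → E), ∀ ζ : E, ∃ c : Fin n → C₀(X, ℂ),
      ζ - ∑ i, c i • ξ i ∈ vanishing E K := by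
  obtain ⟨n, s, hs⟩ := Module.Finite.exists_fin (R := C(K, ℂ)) (M := Restriction E K)
  choose ξ hξ using fun i => Restriction.mk_surjective K (s i)
  refine ⟨n, ξ, fun ζ => ?_⟩
  have h1 : Restriction.mk K ζ ∈ Submodule.span C(K, ℂ) (Set.range s) := hs ▸ Submodule.mem_top
  obtain ⟨c, hc⟩ := (Submodule.mem_span_range_iff_exists_fun _).mp h1
  choose f hf using fun i => restrictC_surjective K (c i)
  refine ⟨f, (Submodule.Quotient.eq (vanishing E K)).mp ?_⟩
  change Restriction.mk K ζ = (vanishing E K).mkQ (∑ i, f i • ξ i)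
  rw [← hc, map_sum]
  refine Finset.sum_congr rfl fun i _ => ?_
  rw [← hf, ← hξ, Restriction.restrictC_smul_mk]
  rfl

/-- The coefficients in `exists_generators` can be bounded by the norm of the element. -/
theorem exists_generators_bounded [CompleteSpace E] {K : Compacts X}
    [Module.Finite C(K, ℂ) (Restriction E K)] :
    ∃ (n : ℕ) (ξ : Fin n → E), ∃ C > 0, ∀ ζ : E, ∃ c : Fin n → C₀(X, ℂ),
      (∀ i, ‖c i‖ ≤ C * ‖ζ‖) ∧ ζ - ∑ i, c i • ξ i ∈ vanishing E K := by
  obtain ⟨n, ξ, hξ⟩ := exists_generators (E := E) (K := K)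
  let m (ζ : E) : C₀(X, ℂ) →L[ℂ] E := LinearMap.mkContinuous
    { toFun f := f • ζ
      map_add' f g := add_smul' f g ζ
      map_smul' c f := smul_assoc' c f ζ } ‖ζ‖
    fun f => (norm_smul_le' f ζ).trans_eq (mul_comm _ _)
  let G : (Fin n → C₀(X, ℂ)) × vanishing E K →L[ℂ] E :=
    (∑ i, (m (ξ i)).comp ((ContinuousLinearMap.proj i).comp (ContinuousLinearMap.fst ℂ _ _))) +
      (vanishing E K).subtypeL.comp (ContinuousLinearMap.snd ℂ _ _)
  have hG (p) : G p = ∑ i, p.1 i • ξ i + (p.2 : E) := by simp [G, m]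
  have : CompleteSpace (vanishing E K) := (isClosed_vanishing K).completeSpace_coe
  -- The map `G` from coefficients and vanishing elements is onto, so the open mapping theorem
  -- supplies the constant.
  obtain ⟨C, hC, h⟩ := G.exists_preimage_norm_le fun ζ => by
    obtain ⟨c, hc⟩ := hξ ζ
    exact ⟨(c, ⟨_, hc⟩), by simp [hG]⟩
  refine ⟨n, ξ, C, hC, fun ζ => ?_⟩
  obtain ⟨p, hp, hpn⟩ := h ζ
  refine ⟨p.1, fun i => (norm_le_pi_norm p.1 i).trans ((norm_fst_le p).trans hpn), ?_⟩
  rw [← hp, hG, add_sub_cancel_left]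
  exact p.2.2

/-- If the restriction of `E` to the support of `f` is finitely generated, then `f T` is small
once the adjoint of `T` is small on finitely many elements. -/
theorem exists_norm_iota_mul_le [CompleteSpace E] {K : Compacts X}
    [Module.Finite C(K, ℂ) (Restriction E K)] {f : C₀(X, ℂ)} (hf : ∀ x ∉ K, f x = 0) :
    ∃ (n : ℕ) (ξ : Fin n → E) (C : ℝ), 0 ≤ C ∧ ∀ T : Adjointable C₀(X, ℂ) E,
      ‖iota C₀(X, ℂ) E f * T‖ ≤ C * ∑ i, ‖star T (ξ i)‖ := by
  obtain ⟨n, ξ, C, hC, h⟩ := exists_generators_bounded (E := E) (K := K)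
  refine ⟨n, ξ, C * ‖f‖, by positivity, fun T => ?_⟩
  have hS : 0 ≤ ∑ i, ‖star T (ξ i)‖ := Finset.sum_nonneg fun _ _ => norm_nonneg _
  refine Adjointable.norm_le_of_bound _ (by positivity) fun ζ => ?_
  rw [Adjointable.mul_apply, iota_apply]
  set η := f • T ζ with hη
  obtain ⟨c, hc, hv⟩ := h η
  rcases (norm_nonneg η).eq_or_lt with h0 | h0
  · rw [← h0]; positivity
  -- Bounding `‖η‖²` rather than `‖η‖` brings in `⟨η, η⟩`. On `K` its second entry may be replaced
  -- by generators with coefficients of size `C‖η‖`, and the factor `‖η‖` cancels; in the first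
  -- entry `T` moves across as `T* ξᵢ`. Off `K` it vanishes because `f` does.
  refine le_of_mul_le_mul_right ?_ h0
  rw [← inner_self_eq_norm_sq (A := C₀(X, ℂ)), ← ZeroAtInftyContinuousMap.norm_toBCF_eq_norm]
  refine (BoundedContinuousFunction.norm_le (by positivity)).mpr fun x => ?_
  change ‖inner C₀(X, ℂ) η η x‖ ≤ _
  by_cases hx : x ∈ K
  · have h1 : inner C₀(X, ℂ) η η x = inner C₀(X, ℂ) η (∑ i, c i • ξ i) x := by
      have := hv η x hx
      rwa [CStarModule.inner_sub_right, ZeroAtInftyContinuousMap.sub_apply, sub_eq_zero] at this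
    have h2 (i : Fin n) : ‖inner C₀(X, ℂ) η (ξ i)‖ ≤ ‖f‖ * (‖ζ‖ * ‖star T (ξ i)‖) := by
      rw [hη, CStarModule.inner_op_smul_left, inner_apply_left, mul_comm ‖f‖, ← norm_star f]
      refine (norm_mul_le _ _).trans ?_
      gcongr
      exact CStarModule.norm_inner_le E
    rw [h1, CStarModule.inner_sum_right]
    calc _ ≤ ‖∑ i, inner C₀(X, ℂ) η (c i • ξ i)‖ := ZeroAtInftyContinuousMap.norm_apply_le _ x
      _ ≤ ∑ i, C * ‖η‖ * (‖f‖ * (‖ζ‖ * ‖star T (ξ i)‖)) := by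
        refine norm_sum_le_of_le _ fun i _ => ?_
        rw [CStarModule.inner_op_smul_right]
        exact (norm_mul_le _ _).trans (mul_le_mul (hc i) (h2 i) (norm_nonneg _) (by positivity))
      _ = _ := by
        simp only [← Finset.mul_sum]
        ring
  · have : inner C₀(X, ℂ) η η x = 0 := by
      rw [hη, CStarModule.inner_op_smul_right, ZeroAtInftyContinuousMap.mul_apply, hf x hx,
        zero_mul]
    rw [this, norm_zero]
    positivity

end HilbertModule

namespace Correspondence

open HilbertModule
open scoped HilbertModule.CStarInstances

/-- Choose a compactly supported `f` with `f (s χ) = 1`. Strong convergence `φ(e) → 1` on finitely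
many generators over the support of `f` makes `ι(f)(1 - φ(e))` small in norm; yet a character
killing `im φ` takes the value `1` on it. -/
theorem exists_apply_phiD_ne_zero {X Y E : Type*} [TopologicalSpace X] [LocallyCompactSpace X]
    [T2Space X] [TopologicalSpace Y] [SMul C₀(X, ℂ) E] [NormedAddCommGroup E] [NormedSpace ℂ E]
    [CompleteSpace E] [CStarModule C₀(X, ℂ) E] {φ : C₀(Y, ℂ) →⋆ₙₐ[ℂ] Adjointable C₀(X, ℂ) E}
    (hfin : ∀ K : Compacts X, Module.Finite C(K, ℂ) (Restriction E K))
    (hproper : IsProper φ) (hnondeg : IsNondegenerate φ) (χ : Spec φ) :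
    ∃ g, χ (phiD φ g) ≠ 0 := by
  obtain ⟨s, hs⟩ := exists_isGelfandDual (iotaD φ) (exists_apply_iotaD_ne_zero hproper)
  obtain ⟨f, hf1, -, hf⟩ := ZeroAtInftyContinuousMap.exists_one_of_isCompact
    (isCompact_singleton (x := s χ)) isOpen_univ (Set.subset_univ _)
  let K : Compacts X := ⟨tsupport f, hf⟩
  have := hfin K
  obtain ⟨n, ξ, C, hC, h⟩ := exists_norm_iota_mul_le (E := E) (K := K) (f := f)
    fun x hx => image_eq_zero_of_notMem_tsupport hx
  by_contra! h0
  have hl := CStarAlgebra.increasingApproximateUnit C₀(Y, ℂ)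
  have h1 : Tendsto (fun e => C * ∑ i, ‖star (1 - φ e) (ξ i)‖)
      (CStarAlgebra.approximateUnit C₀(Y, ℂ)) (𝓝 0) := by
    have h2 (i : Fin n) : Tendsto (fun e => ‖star (1 - φ e) (ξ i)‖)
        (CStarAlgebra.approximateUnit C₀(Y, ℂ)) (𝓝 0) := by
      refine (tendsto_iff_norm_sub_tendsto_zero.mp
        (tendsto_apply_of_isNondegenerate hnondeg hl (ξ i))).congr' ?_
      filter_upwards [hl.eventually_star_eq] with e he
      rw [star_sub, ← map_star, he, star_one, norm_sub_rev]
      rfl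
    simpa using (tendsto_finsetSum Finset.univ fun i _ => h2 i).const_mul C
  obtain ⟨e, he⟩ := (h1.eventually (gt_mem_nhds one_pos)).exists
  have h3 : χ (iotaD φ f - iotaD φ f * phiD φ e) = 1 := by
    rw [map_sub, map_mul, h0, mul_zero, sub_zero, hs.apply_eq, hf1 _ rfl]
  have h4 := WeakDual.CharacterSpace.norm_apply_le_norm χ (iotaD φ f - iotaD φ f * phiD φ e)
  rw [h3, norm_one] at h4
  -- The factor `1 - φ e` need not lie in `D`, but its product with `ι f` does.
  have h5 : ‖iotaD φ f - iotaD φ f * phiD φ e‖ = ‖iota C₀(X, ℂ) E f * (1 - φ e)‖ := by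
    rw [mul_sub, mul_one]
    rfl
  exact absurd ((h4.trans_eq h5).trans (h (1 - φ e))) (not_le.mpr he)

end Correspondence

/-! ### Homomorphisms between generated algebras from maps of characters -/

namespace Correspondence

open HilbertModule WeakDual
open scoped HilbertModule.CStarInstances

section Comparison

variable {A B E F : Type*} [NonUnitalCommCStarAlgebra A] [PartialOrder A] [StarOrderedRing A]
  [NonUnitalCommCStarAlgebra B]
  [SMul A E] [NormedAddCommGroup E] [NormedSpace ℂ E] [CompleteSpace E] [CStarModule A E]
  [SMul A F] [NormedAddCommGroup F] [NormedSpace ℂ F] [CompleteSpace F] [CStarModule A F]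
  {φE : B →⋆ₙₐ[ℂ] Adjointable A E} {φF : B →⋆ₙₐ[ℂ] Adjointable A F}

/-- Continuous `*`-homomorphisms out of `C*(im ι, im φ)` that agree on both images are equal. -/
theorem starHom_ext {D : Type*} [NonUnitalCStarAlgebra D]
    {Φ Ψ : generatedAlgebra φE →⋆ₙₐ[ℂ] D} (hι : ∀ f, Φ (iotaD φE f) = Ψ (iotaD φE f))
    (hφ : ∀ g, Φ (phiD φE g) = Ψ (phiD φE g)) : Φ = Ψ := by
  have hc (Θ : generatedAlgebra φE →⋆ₙₐ[ℂ] D) : Continuous Θ :=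
    AddMonoidHomClass.continuous_of_bound Θ 1 fun a => by
      simpa using NonUnitalStarAlgHom.norm_apply_le Θ a
  ext d
  induction d using generatedAlgebra_induction with
  | iota f => exact hι f
  | phi g => exact hφ g
  | add a b ha hb => rw [map_add, map_add, ha, hb]
  | zero => rw [map_zero, map_zero]
  | mul a b ha hb => rw [map_mul, map_mul, ha, hb]
  | smul c a ha => rw [map_smul, map_smul, ha]
  | star a ha => rw [map_star, map_star, ha]
  | limit u a hu hua =>
    refine tendsto_nhds_unique (((hc Φ).tendsto a).comp hua) ?_
    simpa [Function.comp_def, hu] using ((hc Ψ).tendsto a).comp hua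

/-- Pulling back characters along `p` is given by a `*`-homomorphism as soon as `p` is compatible
with `ι` and `φ`. -/
theorem exists_starHom (p : Spec φF → Spec φE)
    (hι : ∀ χ f, p χ (iotaD φE f) = χ (iotaD φF f))
    (hφ : ∀ χ g, p χ (phiD φE g) = χ (phiD φF g)) :
    ∃ Φ : generatedAlgebra φE →⋆ₙₐ[ℂ] generatedAlgebra φF,
      (∀ f, Φ (iotaD φE f) = iotaD φF f) ∧ ∀ g, Φ (phiD φE g) = phiD φF g := by
  -- The Gelfand transform of `d`, composed with `p`, is again a Gelfand transform. This is clear on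
  -- generators and survives algebra operations and limits, so continuity of `p` is not needed.
  have hex (d : generatedAlgebra φE) :
      ∃ d' : generatedAlgebra φF, ∀ χ : Spec φF, χ d' = p χ d := by
    induction d using generatedAlgebra_induction with
    | iota f => exact ⟨iotaD φF f, fun χ => (hι χ f).symm⟩
    | phi g => exact ⟨phiD φF g, fun χ => (hφ χ g).symm⟩
    | add a b ha hb =>
      obtain ⟨a', ha'⟩ := ha
      obtain ⟨b', hb'⟩ := hb
      exact ⟨a' + b', fun χ => by rw [map_add, map_add, ha', hb']⟩
    | zero => exact ⟨0, fun χ => by rw [map_zero, map_zero]⟩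
    | mul a b ha hb =>
      obtain ⟨a', ha'⟩ := ha
      obtain ⟨b', hb'⟩ := hb
      exact ⟨a' * b', fun χ => by rw [map_mul, map_mul, ha', hb']⟩
    | smul c a ha =>
      obtain ⟨a', ha'⟩ := ha
      exact ⟨c • a', fun χ => by rw [map_smul, map_smul, ha']⟩
    | star a ha =>
      obtain ⟨a', ha'⟩ := ha
      exact ⟨star a', fun χ => by
        rw [CharacterSpace.map_star_of_nonUnital, CharacterSpace.map_star_of_nonUnital, ha']⟩
    | limit u a hu hua =>
      choose v hv using hu
      -- The norm of `v m - v n` is tested on characters `χ`, where it equals the value of `p χ` on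
      -- `u m - u n`.
      have hdist (m n : ℕ) : dist (v m) (v n) ≤ dist (u m) (u n) := by
        rw [dist_eq_norm, dist_eq_norm]
        refine CharacterSpace.norm_le_of_forall_norm_apply_le (norm_nonneg _) fun χ => ?_
        rw [map_sub, hv, hv, ← map_sub]
        exact CharacterSpace.norm_apply_le_norm _ _
      have hcauchy : CauchySeq v := by
        have hu := hua.cauchySeq
        rw [Metric.cauchySeq_iff] at hu ⊢
        exact fun ε hε => (hu ε hε).imp fun N hN m hm n hn =>
          (hdist m n).trans_lt (hN m hm n hn)
      obtain ⟨b, hb⟩ := cauchySeq_tendsto_of_complete hcauchy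
      refine ⟨b, fun χ => tendsto_nhds_unique (((map_continuous χ).tendsto b).comp hb) ?_⟩
      simpa [Function.comp_def, hv] using ((map_continuous (p χ)).tendsto a).comp hua
  choose Φ hΦ using hex
  refine ⟨{
    toFun := Φ
    map_smul' c a := ?_
    map_zero' := ?_
    map_add' a b := ?_
    map_mul' a b := ?_
    map_star' a := ?_ }, fun f => ?_, fun g => ?_⟩
  all_goals refine CharacterSpace.eq_of_forall_apply_eq fun χ => ?_
  · simp only [map_smul, hΦ, MonoidHom.id_apply]
  · simp only [map_zero, hΦ]
  · simp only [map_add, hΦ]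
  · simp only [map_mul, hΦ]
  · simp only [CharacterSpace.map_star_of_nonUnital, hΦ]
  · exact (hΦ _ χ).trans (hι χ f)
  · exact (hΦ _ χ).trans (hφ χ g)

theorem Intertwines.eq {Φ Ψ : generatedAlgebra φE ≃⋆ₐ[ℂ] generatedAlgebra φF}
    (hΦ : Intertwines Φ) (hΨ : Intertwines Ψ) : Φ = Ψ := by
  have := starHom_ext (Φ := (Φ : generatedAlgebra φE →⋆ₙₐ[ℂ] generatedAlgebra φF))
    (Ψ := (Ψ : generatedAlgebra φE →⋆ₙₐ[ℂ] generatedAlgebra φF))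
    (fun f => (hΦ.1 f).trans (hΨ.1 f).symm) (fun g => (hΦ.2 g).trans (hΨ.2 g).symm)
  exact DFunLike.ext _ _ fun d => DFunLike.congr_fun this d

theorem Intertwines.symm {Φ : generatedAlgebra φE ≃⋆ₐ[ℂ] generatedAlgebra φF}
    (hΦ : Intertwines Φ) : Intertwines Φ.symm :=
  ⟨fun f => Φ.symm_apply_eq.mpr (hΦ.1 f).symm, fun g => Φ.symm_apply_eq.mpr (hΦ.2 g).symm⟩

/-- The maps `p` and `q` are not assumed inverse to each other; the induced homomorphisms are, since
both composites fix the generators. -/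
theorem exists_intertwines (p : Spec φF → Spec φE) (q : Spec φE → Spec φF)
    (hpι : ∀ χ f, p χ (iotaD φE f) = χ (iotaD φF f))
    (hpφ : ∀ χ g, p χ (phiD φE g) = χ (phiD φF g))
    (hqι : ∀ χ f, q χ (iotaD φF f) = χ (iotaD φE f))
    (hqφ : ∀ χ g, q χ (phiD φF g) = χ (phiD φE g)) :
    ∃ Φ : generatedAlgebra φE ≃⋆ₐ[ℂ] generatedAlgebra φF, Intertwines Φ := by
  obtain ⟨Φ, hΦ1, hΦ2⟩ := exists_starHom p hpι hpφ
  obtain ⟨Ψ, hΨ1, hΨ2⟩ := exists_starHom q hqι hqφ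
  have h1 : Ψ.comp Φ = NonUnitalStarAlgHom.id ℂ _ :=
    starHom_ext (fun f => by simp [hΦ1, hΨ1]) fun g => by simp [hΦ2, hΨ2]
  have h2 : Φ.comp Ψ = NonUnitalStarAlgHom.id ℂ _ :=
    starHom_ext (fun f => by simp [hΦ1, hΨ1]) fun g => by simp [hΦ2, hΨ2]
  exact ⟨{
    toFun := Φ
    invFun := Ψ
    left_inv := DFunLike.congr_fun h1
    right_inv := DFunLike.congr_fun h2
    map_mul' := map_mul Φ
    map_add' := map_add Φ
    map_star' := map_star Φ
    map_smul' := map_smul Φ }, hΦ1, hΦ2⟩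

/-- The pullback of a character along an isomorphism. -/
theorem Intertwines.exists_pullback {Φ : generatedAlgebra φE ≃⋆ₐ[ℂ] generatedAlgebra φF}
    (hΦ : Intertwines Φ) (χ : Spec φF) : ∃ χ' : Spec φE,
      (∀ f, χ' (iotaD φE f) = χ (iotaD φF f)) ∧ ∀ g, χ' (phiD φE g) = χ (phiD φF g) := by
  have h0 : ∃ a, χ a ≠ 0 := by
    by_contra! h
    exact χ.2.1 (ContinuousLinearMap.ext h)
  refine ⟨CharacterSpace.ofNonUnitalAlgHom ((CharacterSpace.toNonUnitalAlgHom χ).comp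
    ((Φ : generatedAlgebra φE →⋆ₙₐ[ℂ] generatedAlgebra φF) :
      generatedAlgebra φE →ₙₐ[ℂ] generatedAlgebra φF))
    ((map_continuous χ).comp (StarAlgEquiv.isometry Φ).continuous) ?_,
    fun f => congrArg χ (hΦ.1 f), fun g => congrArg χ (hΦ.2 g)⟩
  obtain ⟨a, ha⟩ := h0
  refine ⟨Φ.symm a, ?_⟩
  change χ (Φ (Φ.symm a)) ≠ 0
  rwa [Φ.apply_symm_apply]

end Comparison

/-! ### Fibres of the Gelfand duals and pullback of characters -/

section Duals

variable {X Y E F : Type*} [TopologicalSpace X] [LocallyCompactSpace X] [T2Space X]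
  [TopologicalSpace Y] [LocallyCompactSpace Y] [T2Space Y]
  [SMul C₀(X, ℂ) E] [NormedAddCommGroup E] [NormedSpace ℂ E] [CompleteSpace E]
  [CStarModule C₀(X, ℂ) E]
  [SMul C₀(X, ℂ) F] [NormedAddCommGroup F] [NormedSpace ℂ F] [CompleteSpace F]
  [CStarModule C₀(X, ℂ) F]
  {φE : C₀(Y, ℂ) →⋆ₙₐ[ℂ] Adjointable C₀(X, ℂ) E} {φF : C₀(Y, ℂ) →⋆ₙₐ[ℂ] Adjointable C₀(X, ℂ) F}

theorem exists_isGelfandDual_iotaD (hproper : IsProper φE) :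
    ∃ s, IsGelfandDual (iotaD φE) s :=
  exists_isGelfandDual (iotaD φE) (exists_apply_iotaD_ne_zero hproper)

theorem exists_isGelfandDual_phiD
    (hfin : ∀ K : Compacts X, Module.Finite C(K, ℂ) (Restriction E K))
    (hproper : IsProper φE) (hnondeg : IsNondegenerate φE) :
    ∃ r, IsGelfandDual (phiD φE) r :=
  exists_isGelfandDual (phiD φE) (exists_apply_phiD_ne_zero hfin hproper hnondeg)

/-- A pulled-back character has the same pair `(s, r)`, because functions vanishing at infinity
separate points. -/
theorem image_preimage_subset_of_pullback {sE : Spec φE → X} {rE : Spec φE → Y}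
    {sF : Spec φF → X} {rF : Spec φF → Y}
    (hsE : IsGelfandDual (iotaD φE) sE) (hrE : IsGelfandDual (phiD φE) rE)
    (hsF : IsGelfandDual (iotaD φF) sF) (hrF : IsGelfandDual (phiD φF) rF)
    (h : ∀ χ : Spec φF, ∃ χ' : Spec φE, (∀ f, χ' (iotaD φE f) = χ (iotaD φF f)) ∧
      ∀ g, χ' (phiD φE g) = χ (phiD φF g)) (x : X) :
    rF '' (sF ⁻¹' {x}) ⊆ rE '' (sE ⁻¹' {x}) := by
  rintro _ ⟨χ, rfl, rfl⟩
  obtain ⟨χ', h1, h2⟩ := h χ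
  refine ⟨χ', ZeroAtInftyContinuousMap.eq_of_forall_apply_eq fun f => ?_,
    ZeroAtInftyContinuousMap.eq_of_forall_apply_eq fun g => ?_⟩
  · rw [← hsE.apply_eq, h1, hsF.apply_eq]
  · rw [← hrE.apply_eq, h2, hrF.apply_eq]

theorem exists_pullback_of_image_preimage_subset {sE : Spec φE → X} {rE : Spec φE → Y}
    {sF : Spec φF → X} {rF : Spec φF → Y}
    (hsE : IsGelfandDual (iotaD φE) sE) (hrE : IsGelfandDual (phiD φE) rE)
    (hsF : IsGelfandDual (iotaD φF) sF) (hrF : IsGelfandDual (phiD φF) rF)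
    (h : ∀ x, rF '' (sF ⁻¹' {x}) ⊆ rE '' (sE ⁻¹' {x})) (χ : Spec φF) :
    ∃ χ' : Spec φE, (∀ f, χ' (iotaD φE f) = χ (iotaD φF f)) ∧
      ∀ g, χ' (phiD φE g) = χ (phiD φF g) := by
  obtain ⟨χ', h1, h2⟩ := h (sF χ) ⟨χ, rfl, rfl⟩
  exact ⟨χ', fun f => by rw [hsE.apply_eq, hsF.apply_eq, h1],
    fun g => by rw [hrE.apply_eq, hrF.apply_eq, h2]⟩

end Duals

end Correspondence

theorem mainTheorem11
    {X Y : Type*} [TopologicalSpace X] [LocallyCompactSpace X] [T2Space X]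
    [TopologicalSpace Y] [LocallyCompactSpace Y] [T2Space Y]
    {E F : Type*}
    [SMul C₀(X, ℂ) E] [NormedAddCommGroup E] [NormedSpace ℂ E] [CompleteSpace E]
    [CStarModule C₀(X, ℂ) E]
    [SMul C₀(X, ℂ) F] [NormedAddCommGroup F] [NormedSpace ℂ F] [CompleteSpace F]
    [CStarModule C₀(X, ℂ) F]
    (φE : C₀(Y, ℂ) →⋆ₙₐ[ℂ] Adjointable C₀(X, ℂ) E)
    (φF : C₀(Y, ℂ) →⋆ₙₐ[ℂ] Adjointable C₀(X, ℂ) F)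
    (hE_full : IsFull C₀(X, ℂ) E) (hE_proj : IsSigmaFGProjective X E)
    (hE_proper : IsProper φE) (hE_nondeg : IsNondegenerate φE)
    (hF_full : IsFull C₀(X, ℂ) F) (hF_proj : IsSigmaFGProjective X F)
    (hF_proper : IsProper φF) (hF_nondeg : IsNondegenerate φF) :
    ∃ (sE : Spec φE → X) (rE : Spec φE → Y) (sF : Spec φF → X) (rF : Spec φF → Y),
      IsGelfandDual (iotaD φE) sE ∧ IsGelfandDual (phiD φE) rE ∧
      IsGelfandDual (iotaD φF) sF ∧ IsGelfandDual (phiD φF) rF ∧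
      ((∃ Φ : generatedAlgebra φE ≃⋆ₐ[ℂ] generatedAlgebra φF, Intertwines Φ) ↔
        ∀ x : X, rE '' (sE ⁻¹' {x}) = rF '' (sF ⁻¹' {x})) ∧
      ∀ Φ Ψ : generatedAlgebra φE ≃⋆ₐ[ℂ] generatedAlgebra φF,
        Intertwines Φ → Intertwines Ψ → Φ = Ψ := by
  obtain ⟨sE, hsE⟩ := exists_isGelfandDual_iotaD hE_proper
  obtain ⟨sF, hsF⟩ := exists_isGelfandDual_iotaD hF_proper
  obtain ⟨rE, hrE⟩ := exists_isGelfandDual_phiD (fun K => (hE_proj K).1) hE_proper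
    hE_nondeg
  obtain ⟨rF, hrF⟩ := exists_isGelfandDual_phiD (fun K => (hF_proj K).1) hF_proper
    hF_nondeg
  refine ⟨sE, rE, sF, rF, hsE, hrE, hsF, hrF, ⟨?_, fun h => ?_⟩, fun Φ Ψ hΦ hΨ => hΦ.eq hΨ⟩
  · rintro ⟨Φ, hΦ⟩ x
    exact (image_preimage_subset_of_pullback hsF hrF hsE hrE hΦ.symm.exists_pullback x).antisymm
      (image_preimage_subset_of_pullback hsE hrE hsF hrF hΦ.exists_pullback x)
  -- Equality of the fibres is used as two inclusions, one for each direction of the map between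
  -- character spaces.
  · choose p hpι hpφ using exists_pullback_of_image_preimage_subset hsE hrE hsF hrF
      fun x => (h x).superset
    choose q hqι hqφ using exists_pullback_of_image_preimage_subset hsF hrF hsE hrE
      fun x => (h x).subset
    exact exists_intertwines p q hpι hpφ hqι hqφ
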